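/- Let $R$ be a Dedekind domain whose ideal class group $\mathrm{Cl}(R)$ is a torsion group, and let $\mathcal O\subseteq R$ be an order, i.e. a subring with the same quotient field as $R$ such that $R$ is a finitely generated $\mathcal O$-module. Let $\mathfrak f=\{x\in R\mid xR\subseteq\mathcal O\}$ be its conductor, and suppose that $R/\mathfrak f$ is finite and that every class of $\mathrm{Cl}(R)$ contains a nonzero prime ideal of $R$ coprime to $\mathfrak f$. All monoids are commutative and cancellative. A monoid $H$ with quotient group $\mathsf q(H)$ is a Krull monoid if it is completely integrally closed (every $x\in\mathsf q(H)$ for which there is $c\in H$ with $cx^n\in H$ for all $n\ge 1$ lies in $H$) and satisfies the ascending chain condition on $v$-ideals, i.e. on the sets $I\subseteq H$ with $(H:(H:I))=I$, where $(H:X)=\{x\in\mathsf q(H)\mid xX\subseteq H\}$. A monoid homomorphism $\theta\colon H\to B$ is a transfer homomorphism if $B=\theta(H)B^\times$, $\theta^{-1}(B^\times)=H^\times$, and whenever $\theta(u)=bc$ with $u\in H$ and $b,c\in B$, there are $v,w\in H$ with $u=vw$ such that $\theta(v)$ is associated to $b$ and $\theta(w)$ is associated to $c$ in $B$. The order $\mathcal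 O$ is called transfer Krull if there is a transfer homomorphism from the multiplicative monoid $\mathcal O\setminus\{0\}$ to some Krull monoid. Suppose that $\mathcal O$ is transfer Krull and that the groups $\mathrm{Pic}(\mathcal O)$ and $\mathrm{Cl}(R)$ are isomorphic. Then $\mathcal O\subseteq R$ is a root extension, i.e. for every $a\in R$ there is an integer $n\ge 1$ with $a^n\in\mathcal O$. Moreover, the map $\mathrm{Spec}(R)\to\mathrm{Spec}(\mathcal O)$, $P\mapsto P\cap\mathcal O$, is bijective; in particular, over every prime ideal of $\mathcal O$ containing $\mathfrak f$ there lies exactly one prime ideal of $R$. -/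

import Mathlib

universe u v

/-! ### Transfer Krull monoids

A monoid is commutative and cancellative, written multiplicatively; its quotient group is
`Algebra.GrothendieckGroup H`, with canonical (injective) map `Algebra.GrothendieckGroup.of`. -/

namespace TransferKrull

open Algebra

/-- `x ∈ q(H)` lies in the complete integral closure of `H`: there is `c ∈ H` such that
`c * x ^ n ∈ H` for all positive integers `n`. -/
def IsAlmostIntegral (H : Type u) [CommMonoid H] (x : GrothendieckGroup H) : Prop :=
  ∃ c : H, ∀ n : ℕ, 0 < n →
    GrothendieckGroup.of c * x ^ n ∈ Set.range (GrothendieckGroup.of : H →* GrothendieckGroup H)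

/-- `(H : X) = {x ∈ q(H) | x X ⊆ H}` for a subset `X` of the quotient group `q(H)`. -/
def colon (H : Type u) [CommMonoid H] (X : Set (GrothendieckGroup H)) :
    Set (GrothendieckGroup H) :=
  {x | ∀ y ∈ X, x * y ∈ Set.range (GrothendieckGroup.of : H →* GrothendieckGroup H)}

/-- `X_v = (H : (H : X))`. -/
def vClosure (H : Type u) [CommMonoid H] (X : Set (GrothendieckGroup H)) :
    Set (GrothendieckGroup H) :=
  colon H (colon H X)

/-- `I ⊆ H` is a `v`-ideal (divisorial ideal) of `H` if `I_v = I`. No zero element is adjoined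
to `H`; the zero ideal corresponds to `I = ∅`. -/
def IsVIdeal {H : Type u} [CommMonoid H] (I : Set H) : Prop :=
  vClosure H (GrothendieckGroup.of '' I) = GrothendieckGroup.of '' I

/-- A Krull monoid: a cancellative commutative monoid that is completely integrally closed and
satisfies the ascending chain condition on `v`-ideals. -/
structure IsKrullMonoid (H : Type u) [CommMonoid H] : Prop where
  cancel : IsCancelMul H
  completelyIntegrallyClosed : ∀ x : GrothendieckGroup H, IsAlmostIntegral H x →
    x ∈ Set.range (GrothendieckGroup.of : H →* GrothendieckGroup H)
  acc : WellFoundedGT {I : Set H // IsVIdeal I}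

/-- Transfer homomorphisms: `B = θ(H) B^×`, `θ⁻¹(B^×) = H^×`, and factorizations
`θ(u) = b c` lift to `H` up to associates. -/
structure IsTransferHom {H : Type u} {B : Type v} [CommMonoid H] [CommMonoid B]
    (θ : H →* B) : Prop where
  surj : ∀ b : B, ∃ h : H, Associated (θ h) b
  isUnit_iff : ∀ h : H, IsUnit (θ h) ↔ IsUnit h
  lift : ∀ (x : H) (b c : B), θ x = b * c →
    ∃ y z : H, x = y * z ∧ Associated (θ y) b ∧ Associated (θ z) c

/-- `H` is transfer Krull: it has a transfer homomorphism to some Krull monoid `B`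
(`B` is allowed to live in an arbitrary universe). -/
def IsTransferKrull (H : Type u) [CommMonoid H] : Prop :=
  ∃ (B : Type v) (_ : CommMonoid B) (θ : H →* B), IsKrullMonoid B ∧ IsTransferHom θ

/-! ### Orders in Dedekind domains -/

/-- The subring `O` is an order in `R`: it has the same quotient field as `R`, and `R` is a
finitely generated `O`-module. -/
structure IsOrder {R : Type u} [CommRing R] (O : Subring R) : Prop where
  isFractionRing : IsFractionRing O (FractionRing R)
  finite : Module.Finite O R

/-- The conductor `{x ∈ R | x R ⊆ O}`, the greatest ideal of `R` contained in `O`. -/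
def conductor {R : Type u} [CommRing R] (O : Subring R) : Ideal R where
  carrier := {x | ∀ r : R, x * r ∈ O}
  zero_mem' := fun r => by simp [O.zero_mem]
  add_mem' := fun {a b} ha hb r => by
    rw [add_mul]
    exact O.add_mem (ha r) (hb r)
  smul_mem' := fun c x hx r => by
    have h : c • x * r = x * (c * r) := by
      rw [smul_eq_mul]
      ring
    rw [h]
    exact hx (c * r)

/-- `O ⊆ R` is a root extension: every element of `R` has a positive power in `O`. -/
def IsRootExtension {R : Type u} [CommRing R] (O : Subring R) : Prop :=
  ∀ a : R, ∃ n : ℕ, 0 < n ∧ a ^ n ∈ O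

end TransferKrull

/-!
The core is the injectivity of `Spec R → Spec O` (`IsOrder.comap_injective`). Let `𝔣` be the
conductor and suppose that primes `P ≠ Q` of `R` lie over the same prime `p` of `O`. As `Cl(R)` is
torsion and only finitely many primes lie over `p`, there are `a, b ∈ R` such that `P` is the only
prime containing `a`, while the primes containing `b` are precisely those over `p` other than `P`.
As `R / 𝔣` is finite, powers of `a` and `b` are idempotent modulo `𝔣`, so `a` and `b` may be taken
so themselves. An element of `R` that is idempotent modulo `𝔣` lies in `O` as soon as its
membership in a prime `M` depends only on `M ∩ O` (`mem_of_isIdempotentElem_mk`): idempotents of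
the finite ring `O / 𝔣` correspond to arbitrary subsets of its spectrum, and an idempotent of
`R / 𝔣` is determined by the primes containing it. Hence `a ^ i * b ^ j ∈ O` for all `i, j ≥ 1`.

Let `θ` be a transfer homomorphism to a Krull monoid `B`. The quotients `α = θ(a²b) / θ(ab)` and
`β = θ(ab²) / θ(ab)` are almost integral over `B`, so they lie in `B`, and `α β = θ(ab)` is not a
unit. If `β` is not a unit, then `θ(ab) β ^ n = θ(a b ^ (n + 1))` lifts to a factorization of
`a b ^ (n + 1)` in `O` with at least `n` nonunit factors
(`IsTransferKrull.exists_long_factorization`). Each of these lies in `p`, because all primes of `R`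
containing `a b` lie over `p`; so `a b ^ (n + 1) ∈ P ^ n` for all `n`, which is absurd since
`b ∉ P` and `a ≠ 0`. If `α` is not a unit, exchange the roles of `a` and `b`, and of `P` and `Q`.

Surjectivity is lying over. For the root extension property, some positive power of a given element
of `R` is idempotent modulo `𝔣`, and by injectivity the membership criterion applies to it.
-/

namespace TransferKrull

open Algebra

/-! ### Long factorizations over a completely integrally closed monoid -/

/-- If `s * (t / s) ^ n` lies in `B` for all `n`, then so does `t / s`: this is complete integral
closure, phrased without the quotient group. -/
theorem IsKrullMonoid.dvd_of_forall_pow {B : Type u} [CommMonoid B] (hB : IsKrullMonoid B)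
    {s t : B} (h : ∀ n : ℕ, ∃ y : B, s ^ n * y = s * t ^ n) : s ∣ t := by
  have := hB.cancel
  obtain ⟨α, hα⟩ := hB.completelyIntegrallyClosed
    (GrothendieckGroup.of t / GrothendieckGroup.of s) ⟨s, fun n _ => by
      obtain ⟨y, hy⟩ := h n
      refine ⟨y, ?_⟩
      have := congrArg (GrothendieckGroup.of (M := B)) hy
      simp only [map_mul, map_pow] at this
      rw [div_pow, ← mul_div_assoc, ← this, mul_comm, mul_div_cancel_right]⟩
  refine ⟨α, GrothendieckGroup.of_injective ?_⟩
  rw [map_mul, hα, mul_div_cancel]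

/-- A factorization of `θ x` with `N` nonunit factors `β` lifts to `N` nonunits whose product
divides `x`. -/
theorem IsTransferHom.exists_multiset_prod_dvd {H : Type u} {B : Type v} [CommMonoid H]
    [CommMonoid B] {θ : H →* B} (hθ : IsTransferHom θ) {β t : B} (hβ : ¬ IsUnit β) (N : ℕ)
    {x : H} (hx : Associated (θ x) (t * β ^ N)) :
    ∃ m : Multiset H, m.card = N ∧ (∀ d ∈ m, ¬ IsUnit d) ∧ m.prod ∣ x := by
  induction N generalizing x with
  | zero => exact ⟨0, by simp⟩
  | succ N ih =>
    obtain ⟨w, hw⟩ := hx.symm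
    obtain ⟨y, z, rfl, hy, hz⟩ := hθ.lift x (t * β ^ N * w) β (by
      rw [← hw, pow_succ]; simp only [mul_comm, mul_left_comm])
    obtain ⟨m, rfl, hm, hmy⟩ := ih (hy.trans (associated_mul_unit_left _ _ w.isUnit))
    refine ⟨z ::ₘ m, by simp, ?_, ?_⟩
    · intro d hd
      rcases Multiset.mem_cons.1 hd with rfl | hd
      · rw [← hθ.isUnit_iff, hz.isUnit_iff]
        exact hβ
      · exact hm d hd
    · rw [Multiset.prod_cons, mul_comm y z]
      exact mul_dvd_mul_left z hmy

/-- In the quotient group of `H`, the hypotheses say `(p / s) * (q / s) = s`,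
`x n = s * (p / s) ^ n` and `y n = s * (q / s) ^ n`. Although `p / s` and `q / s` need not lie in `H`, their images lie in
any completely integrally closed monoid to which `H` transfers, and one of them is not a unit
there. -/
theorem IsTransferKrull.exists_long_factorization {H : Type u} [CommMonoid H]
    (hH : IsTransferKrull.{u, v} H) {s p q : H} (hs : ¬ IsUnit s) (hpq : p * q = s ^ 3)
    {x y : ℕ → H} (hx : ∀ n, s ^ n * x n = s * p ^ n) (hy : ∀ n, s ^ n * y n = s * q ^ n) :
    (∀ n, ∃ m : Multiset H, m.card = n ∧ (∀ d ∈ m, ¬ IsUnit d) ∧ m.prod ∣ x n) ∨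
    (∀ n, ∃ m : Multiset H, m.card = n ∧ (∀ d ∈ m, ¬ IsUnit d) ∧ m.prod ∣ y n) := by
  obtain ⟨B, _, θ, hB, hθ⟩ := hH
  have := hB.cancel
  obtain ⟨α, hα⟩ : θ s ∣ θ p := hB.dvd_of_forall_pow fun n =>
    ⟨θ (x n), by simpa only [map_mul, map_pow] using congrArg θ (hx n)⟩
  obtain ⟨β, hβ⟩ : θ s ∣ θ q := hB.dvd_of_forall_pow fun n =>
    ⟨θ (y n), by simpa only [map_mul, map_pow] using congrArg θ (hy n)⟩
  have hαβ : α * β = θ s := by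
    have h := congrArg θ hpq
    rw [map_mul, map_pow, hα, hβ, mul_mul_mul_comm, pow_succ, sq] at h
    exact mul_left_cancel h
  have key : ∀ {r : H} {γ : B} {z : ℕ → H}, θ r = θ s * γ → (∀ n, s ^ n * z n = s * r ^ n) →
      ∀ n, θ (z n) = θ s * γ ^ n := by
    intro r γ z hr hz n
    have h := congrArg θ (hz n)
    rw [map_mul, map_mul, map_pow, map_pow, hr, mul_pow, mul_left_comm] at h
    exact mul_left_cancel h
  have hunit : ¬ IsUnit α ∨ ¬ IsUnit β := by
    by_contra! h
    exact hs ((hθ.isUnit_iff s).1 (hαβ ▸ h.1.mul h.2))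
  rcases hunit with h | h
  · exact .inl fun n => hθ.exists_multiset_prod_dvd h n (.of_eq (key hα hx n))
  · exact .inr fun n => hθ.exists_multiset_prod_dvd h n (.of_eq (key hβ hy n))

/-! ### Idempotents of a finite ring lying in a subring -/

theorem exists_pow_isIdempotentElem {M : Type u} [Monoid M] [Finite M] (a : M) :
    ∃ n : ℕ, 0 < n ∧ IsIdempotentElem (a ^ n) := by
  obtain ⟨m, n, hmn, h⟩ : ∃ m n : ℕ, m < n ∧ a ^ m = a ^ n := by
    obtain ⟨m, n, hne, h⟩ := Finite.exists_ne_map_eq_of_infinite (fun n : ℕ => a ^ n)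
    rcases hne.lt_or_gt with hlt | hlt
    · exact ⟨m, n, hlt, h⟩
    · exact ⟨n, m, hlt, h.symm⟩
  obtain ⟨d, rfl⟩ := Nat.exists_eq_add_of_lt hmn
  have step : ∀ k, m ≤ k → ∀ j, a ^ (k + j * (d + 1)) = a ^ k := by
    intro k hk j
    induction j with
    | zero => simp
    | succ j ih =>
      obtain ⟨l, rfl⟩ := Nat.exists_eq_add_of_le hk
      rw [← ih, show m + l + (j + 1) * (d + 1) = (m + d + 1) + (l + j * (d + 1)) by ring,
        pow_add, ← h, ← pow_add, ← add_assoc]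
  refine ⟨(m + 1) * (d + 1), by positivity, ?_⟩
  rw [IsIdempotentElem, ← pow_add]
  exact step _ (by nlinarith) _

/-- The spectrum of the finite ring `A` is discrete, so some idempotent of `A` is contained in
exactly the primes lying below those containing `e`; in `S` it has the same basic open set as `e`,
hence equals `e`. -/
theorem mem_of_isIdempotentElem_of_finite {S : Type u} [CommRing S] [Finite S]
    (A : Subring S) {e : S} (he : IsIdempotentElem e)
    (h : ∀ P Q : Ideal S, P.IsPrime → Q.IsPrime →
      P.comap A.subtype = Q.comap A.subtype → e ∈ P → e ∈ Q) : e ∈ A := by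
  obtain ⟨f, hf, hfe⟩ := PrimeSpectrum.exists_idempotent_basicOpen_eq_of_isClopen
    (isClopen_discrete (PrimeSpectrum.comap A.subtype '' (PrimeSpectrum.basicOpen e)))
  have : (f : S) = e := by
    refine PrimeSpectrum.basicOpen_injOn_isIdempotentElem (hf.map A.subtype) he ?_
    ext P
    have hP := Set.ext_iff.1 hfe (PrimeSpectrum.comap A.subtype P)
    simp only [SetLike.mem_coe, PrimeSpectrum.mem_basicOpen, Set.mem_image,
      PrimeSpectrum.comap_asIdeal, Ideal.mem_comap] at hP ⊢
    refine hP.symm.trans ⟨?_, fun h => ⟨P, h, rfl⟩⟩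
    rintro ⟨Q, hQ, hQP⟩ hP
    exact hQ (h P.asIdeal Q.asIdeal P.2 Q.2 (congrArg PrimeSpectrum.asIdeal hQP).symm hP)
  exact this ▸ f.2

/-! ### Orders and their conductors -/

variable {R : Type u} [CommRing R] {O : Subring R}

theorem mem_of_mem_conductor {x : R} (hx : x ∈ conductor O) : x ∈ O := by
  simpa using hx 1

/-- Membership in `O` of an element that is idempotent modulo the conductor, and whose vanishing at
a prime of `R` depends only on the prime of `O` below it. -/
theorem mem_of_isIdempotentElem_mk [Finite (R ⧸ conductor O)] {e : R}
    (he : IsIdempotentElem (Ideal.Quotient.mk (conductor O) e))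
    (h : ∀ P Q : PrimeSpectrum R,
      PrimeSpectrum.comap O.subtype P = PrimeSpectrum.comap O.subtype Q →
        e ∈ P.asIdeal → e ∈ Q.asIdeal) : e ∈ O := by
  have hmem := mem_of_isIdempotentElem_of_finite
    (O.map (Ideal.Quotient.mk (conductor O))) he fun P Q _ _ hPQ heP => by
      refine h ⟨P.comap (Ideal.Quotient.mk _), inferInstance⟩
        ⟨Q.comap (Ideal.Quotient.mk _), inferInstance⟩ (PrimeSpectrum.ext (Ideal.ext fun x => ?_))
        heP
      exact Ideal.ext_iff.1 hPQ ⟨Ideal.Quotient.mk _ x, x, x.2, rfl⟩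
  obtain ⟨x, hx, hxe⟩ := hmem
  have := mem_of_mem_conductor (Ideal.Quotient.eq.1 hxe)
  simpa using O.sub_mem hx this

theorem IsOrder.isIntegral (hO : IsOrder O) : Algebra.IsIntegral O R := by
  have := hO.finite
  infer_instance

theorem isRootExtension_of_injective [Finite (R ⧸ conductor O)]
    (h : Function.Injective (PrimeSpectrum.comap O.subtype)) : IsRootExtension O := by
  intro a
  obtain ⟨n, hn, hidem⟩ := exists_pow_isIdempotentElem (Ideal.Quotient.mk (conductor O) a)
  rw [← map_pow] at hidem
  exact ⟨n, hn, mem_of_isIdempotentElem_mk hidem fun P Q hPQ hP => h hPQ ▸ hP⟩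

theorem IsOrder.exists_isPrime_mem_of_not_isUnit [IsDomain R] (hO : IsOrder O) {d : O}
    (hd : ¬ IsUnit d) : ∃ M : PrimeSpectrum R, (d : R) ∈ M.asIdeal := by
  have := hO.isIntegral
  obtain ⟨m, hm, hdm⟩ := exists_max_ideal_of_mem_nonunits hd
  obtain ⟨M, hM, hMm⟩ := Ideal.exists_ideal_over_maximal_of_isIntegral (S := R) m (by
    rw [(RingHom.injective_iff_ker_eq_bot _).1 Subtype.val_injective]
    exact bot_le)
  exact ⟨⟨M, hM.isPrime⟩, by rw [← hMm] at hdm; exact hdm⟩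

theorem exists_isIdempotentElem_mk [IsDomain R] (I : Ideal R) [Finite (R ⧸ I)] {a : R}
    (ha : a ≠ 0) : ∃ b : R, b ≠ 0 ∧ IsIdempotentElem (Ideal.Quotient.mk I b) ∧
      ∀ M : PrimeSpectrum R, b ∈ M.asIdeal ↔ a ∈ M.asIdeal := by
  obtain ⟨n, hn, h⟩ := exists_pow_isIdempotentElem (Ideal.Quotient.mk I a)
  rw [← map_pow] at h
  exact ⟨a ^ n, pow_ne_zero n ha, h, fun M => M.2.pow_mem_iff_mem n hn⟩

/-! ### Injectivity on spectra over a Dedekind domain with torsion class group -/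

/-- Torsion of the class group makes some positive power of `P` principal; its generator lies in
no prime other than `P`. -/
theorem exists_mem_iff_eq_of_isOfFinOrder [IsDedekindDomain R]
    (htors : ∀ c : ClassGroup R, IsOfFinOrder c) (P : PrimeSpectrum R) (hP : P.asIdeal ≠ ⊥) :
    ∃ g : R, g ≠ 0 ∧ ∀ Q : PrimeSpectrum R, g ∈ Q.asIdeal ↔ Q = P := by
  obtain ⟨n, hn, hpow⟩ := (isOfFinOrder_iff_pow_eq_one.1
    (htors (ClassGroup.mk0 ⟨P.asIdeal, mem_nonZeroDivisors_of_ne_zero hP⟩)))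
  rw [← map_pow, SubmonoidClass.mk_pow, ClassGroup.mk0_eq_one_iff] at hpow
  obtain ⟨g, hg⟩ := hpow
  rw [Ideal.submodule_span_eq] at hg
  refine ⟨g, ?_, fun Q => ?_⟩
  · rintro rfl
    rw [Ideal.span_singleton_eq_bot.2 rfl] at hg
    exact pow_ne_zero n hP hg
  · rw [← Ideal.span_singleton_le_iff_mem, ← hg, Q.2.pow_le_iff hn.ne']
    have := P.2.isMaximal hP
    exact ⟨fun h => PrimeSpectrum.ext (this.eq_of_le Q.2.ne_top h).symm, fun h => h ▸ le_rfl⟩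

theorem exists_forall_mul_pow_notMem_pow [IsDedekindDomain R] {P : Ideal R} (hP : P.IsPrime)
    (hP0 : P ≠ ⊥) {a b : R} (ha : a ≠ 0) (hb : b ∉ P) :
    ∃ n : ℕ, ∀ i : ℕ, a * b ^ i ∉ P ^ n := by
  have hbot := Ideal.iInf_pow_eq_bot_of_isDomain P hP.ne_top
  obtain ⟨n, hn⟩ : ∃ n, a ∉ P ^ n := by
    by_contra! h
    exact ha (by simpa [hbot] using Ideal.mem_iInf.2 h)
  refine ⟨n, fun i hi => hn ?_⟩
  rw [← Ideal.dvd_span_singleton] at hi ⊢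
  rw [← Ideal.span_singleton_mul_span_singleton] at hi
  refine (Ideal.prime_of_isPrime hP0 hP).pow_dvd_of_dvd_mul_right n (fun h => hb ?_) hi
  exact hP.mem_of_pow_mem i (Ideal.dvd_span_singleton.1 h)

theorem isUnit_nonZeroDivisors_of_isUnit_coe {A : Type u} [CommRing A] {d : nonZeroDivisors A}
    (hd : IsUnit (d : A)) : IsUnit d := by
  obtain ⟨e, he⟩ := hd.exists_right_inv
  refine IsUnit.of_mul_eq_one ⟨e, ?_⟩ (Subtype.ext he)
  exact (IsUnit.of_mul_eq_one (d : A) (by rw [mul_comm]; exact he)).mem_nonZeroDivisors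

/-- If all primes of `R` containing `z` lie over the same prime of `O` as `P`, then every nonunit
divisor of `z` in `O` lies in that prime, hence in `P`. The `P`-adic valuation of `z` therefore
bounds the lengths of its factorizations. -/
theorem IsOrder.mem_pow_of_multiset_prod_dvd [IsDomain R] (hO : IsOrder O) {P : PrimeSpectrum R}
    {z : nonZeroDivisors O}
    (hz : ∀ M : PrimeSpectrum R, ((z : O) : R) ∈ M.asIdeal →
      PrimeSpectrum.comap O.subtype M = PrimeSpectrum.comap O.subtype P)
    {m : Multiset (nonZeroDivisors O)} (hm : ∀ d ∈ m, ¬ IsUnit d) (hmz : m.prod ∣ z) :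
    ((z : O) : R) ∈ P.asIdeal ^ m.card := by
  have key : ∀ d ∈ m, ((d : O) : R) ∈ P.asIdeal := by
    intro d hd
    obtain ⟨M, hM⟩ := hO.exists_isPrime_mem_of_not_isUnit
      (fun h => hm d hd (isUnit_nonZeroDivisors_of_isUnit_coe h))
    obtain ⟨w, rfl⟩ := (Multiset.dvd_prod hd).trans hmz
    exact (PrimeSpectrum.ext_iff.1 (hz M (M.asIdeal.mul_mem_right _ hM))).le hM
  have hprod : ((m.prod : O) : R) ∈ P.asIdeal ^ m.card := by
    clear hm hmz
    induction m using Multiset.induction_on with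
    | empty => simp
    | cons d m ih =>
      rw [Multiset.prod_cons, Multiset.card_cons, pow_succ']
      exact Ideal.mul_mem_mul (key d (Multiset.mem_cons_self d m))
        (ih fun e he => key e (Multiset.mem_cons_of_mem he))
  obtain ⟨w, rfl⟩ := hmz
  exact Ideal.mul_mem_right _ _ hprod

theorem IsOrder.comap_injective [IsDedekindDomain R] (hO : IsOrder O)
    [Finite (R ⧸ conductor O)] (htors : ∀ c : ClassGroup R, IsOfFinOrder c)
    (hTK : IsTransferKrull.{u, v} (nonZeroDivisors O)) :
    Function.Injective (PrimeSpectrum.comap O.subtype) := by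
  classical
  intro P Q hPQ
  by_contra hne
  have := hO.finite
  have := hO.isIntegral
  set φ := PrimeSpectrum.comap O.subtype
  -- By integrality `⊥` is the only prime of `R` over its contraction, so `P` and `Q` are nonzero.
  have hne_bot : ∀ {M N : PrimeSpectrum R}, φ M = φ N → M.asIdeal = ⊥ → M = N := by
    intro M N hMN hM
    refine PrimeSpectrum.ext (hM.trans (Ideal.eq_bot_of_comap_eq_bot (R := O) ?_).symm)
    refine (PrimeSpectrum.ext_iff.1 hMN).symm.trans ?_
    change M.asIdeal.comap O.subtype = ⊥
    rw [hM]
    exact (RingHom.injective_iff_ker_eq_bot _).1 Subtype.val_injective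
  have hfiber : ∀ M : PrimeSpectrum R, φ M = φ P → M.asIdeal ≠ ⊥ := by
    intro M hM h0
    exact hne ((hne_bot hM h0).symm.trans (hne_bot (hM.trans hPQ) h0))
  choose! g hg0 hg using fun (M : PrimeSpectrum R) (hM : φ M = φ P) =>
    exists_mem_iff_eq_of_isOfFinOrder htors M (hfiber M hM)
  have hT : (φ ⁻¹' {φ P}).Finite :=
    Algebra.QuasiFinite.finite_comap_preimage_singleton (R := O) (S := R) (φ P)
  obtain ⟨a, ha0, hai, ha⟩ := exists_isIdempotentElem_mk (conductor O) (hg0 P rfl)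
  simp only [hg P rfl] at ha
  obtain ⟨b, hb0, hb⟩ : ∃ b : R, b ≠ 0 ∧
      ∀ M : PrimeSpectrum R, b ∈ M.asIdeal ↔ φ M = φ P ∧ M ≠ P := by
    refine ⟨∏ M ∈ hT.toFinset.erase P, g M, ?_, fun M => ?_⟩
    · refine Finset.prod_ne_zero_iff.2 fun M hM => hg0 M ?_
      simpa using (Finset.mem_erase.1 hM).2
    · rw [M.2.prod_mem_iff]
      constructor
      · rintro ⟨N, hN, hNM⟩
        simp only [Finset.mem_erase, Set.Finite.mem_toFinset, Set.mem_preimage,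
          Set.mem_singleton_iff] at hN
        rw [(hg N hN.2 M).1 hNM]
        exact hN.symm
      · rintro ⟨hM, hMP⟩
        exact ⟨M, by simpa using ⟨hMP, hM⟩, (hg M hM M).2 rfl⟩
  obtain ⟨b, hb0', hbi, hb'⟩ := exists_isIdempotentElem_mk (conductor O) hb0
  simp only [hb] at hb'
  clear hb0 hb
  have hab : ∀ (i j : ℕ) (M : PrimeSpectrum R),
      a ^ (i + 1) * b ^ (j + 1) ∈ M.asIdeal ↔ φ M = φ P := by
    intro i j M
    rw [M.2.mul_mem_iff_mem_or_mem, M.2.pow_mem_iff_mem _ i.succ_pos,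
      M.2.pow_mem_iff_mem _ j.succ_pos, ha, hb']
    by_cases h : M = P <;> simp [h]
  have hmem : ∀ i j : ℕ, a ^ (i + 1) * b ^ (j + 1) ∈ O := by
    intro i j
    refine mem_of_isIdempotentElem_mk ?_ fun M N hMN hM => ?_
    · rw [map_mul, map_pow, map_pow]
      exact (hai.pow _).mul (hbi.pow _)
    · rw [hab] at hM ⊢
      exact hMN.symm.trans hM
  -- Exponents are shifted by one: `c i j = a ^ (i + 1) * b ^ (j + 1)`.
  let c : ℕ → ℕ → nonZeroDivisors O := fun i j =>
    ⟨⟨a ^ (i + 1) * b ^ (j + 1), hmem i j⟩, mem_nonZeroDivisors_of_ne_zero fun h =>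
      mul_ne_zero (pow_ne_zero _ ha0) (pow_ne_zero _ hb0') (congrArg Subtype.val h)⟩
  have hc : ∀ i j, ((c i j : O) : R) = a ^ (i + 1) * b ^ (j + 1) := fun _ _ => rfl
  have hext : ∀ {x y : nonZeroDivisors O}, ((x : O) : R) = ((y : O) : R) → x = y :=
    fun h => Subtype.ext (Subtype.ext h)
  have hunit : ¬ IsUnit (c 0 0) := by
    intro h
    have h1 : IsUnit ((c 0 0 : O) : R) :=
      (h.map (nonZeroDivisors O).subtype).map O.subtype
    exact P.2.ne_top (Ideal.eq_top_of_isUnit_mem _ ((hab 0 0 P).2 rfl) h1)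
  rcases hTK.exists_long_factorization (p := c 1 0) (q := c 0 1) hunit
    (hext (by push_cast [hc]; ring)) (x := fun n => c n 0) (y := fun n => c 0 n)
    (fun n => hext (by push_cast [hc]; ring)) (fun n => hext (by push_cast [hc]; ring))
    with h | h
  -- `c n 0` has bounded `Q`-adic valuation, `c 0 n` bounded `P`-adic valuation.
  · obtain ⟨n, hn⟩ := exists_forall_mul_pow_notMem_pow (P := Q.asIdeal) (b := a)
      Q.2 (hfiber Q hPQ.symm) (pow_ne_zero 1 hb0') (fun h => hne ((ha Q).1 h).symm)
    obtain ⟨m, rfl, hm, hmz⟩ := h n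
    refine hn (m.card + 1) ?_
    rw [mul_comm]
    exact hO.mem_pow_of_multiset_prod_dvd (fun M hM => ((hab _ _ M).1 hM).trans hPQ) hm hmz
  · obtain ⟨n, hn⟩ := exists_forall_mul_pow_notMem_pow (P := P.asIdeal) (b := b)
      P.2 (hfiber P rfl) (pow_ne_zero 1 ha0) (fun h => ((hb' P).1 h).2 rfl)
    obtain ⟨m, rfl, hm, hmz⟩ := h n
    exact hn (m.card + 1)
      (hO.mem_pow_of_multiset_prod_dvd (fun M hM => (hab _ _ M).1 hM) hm hmz)

end TransferKrull

theorem proposition4p1 {R : Type u} [CommRing R] [IsDedekindDomain R]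
    (O : Subring R) (hO : TransferKrull.IsOrder O)
    -- standing assumptions on `R` and the conductor
    (htors : ∀ c : ClassGroup R, IsOfFinOrder c)
    (hfin : Finite (R ⧸ TransferKrull.conductor O))
    (hprime : ∀ c : ClassGroup R, ∃ P : nonZeroDivisors (Ideal R),
      (P : Ideal R).IsPrime ∧ IsCoprime (P : Ideal R) (TransferKrull.conductor O) ∧
        ClassGroup.mk0 P = c)
    -- `O` is transfer Krull, and `Pic(O) ≅ Cl(R)`
    (hTK : TransferKrull.IsTransferKrull.{u, v} (nonZeroDivisors O))
    (hPic : Nonempty (CommRing.Pic O ≃* ClassGroup R)) :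
    TransferKrull.IsRootExtension O ∧
    Function.Bijective (PrimeSpectrum.comap O.subtype) ∧
    ∀ p : PrimeSpectrum O,
      Ideal.comap O.subtype (TransferKrull.conductor O) ≤ p.asIdeal →
        ∃! P : PrimeSpectrum R, PrimeSpectrum.comap O.subtype P = p := by
  have := hO.isIntegral
  have hinj := hO.comap_injective htors hTK
  have hsurj : Function.Surjective (PrimeSpectrum.comap O.subtype) :=
    Algebra.IsIntegral.comap_surjective O R
  have hbij : Function.Bijective (PrimeSpectrum.comap O.subtype) := ⟨hinj, hsurj⟩
  exact ⟨TransferKrull.isRootExtension_of_injective hinj, hbij,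
    fun p _ => hbij.existsUnique p⟩
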